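/- Let $n,d$ be natural numbers and let $R$ be a commutative ring with identity. Let the symmetric group $S_d$ act on $(R^n)^{\otimes d}$ by place permutation, $\sigma(v_1\otimes\cdots\otimes v_d)=v_{\sigma^{-1}(1)}\otimes\cdots\otimes v_{\sigma^{-1}(d)}$, and let $GL_n(R)$ act diagonally, $g(v_1\otimes\cdots\otimes v_d)=gv_1\otimes\cdots\otimes gv_d$. These actions commute, so, extended linearly to the group algebras, they give algebra homomorphisms $$\rho\colon RGL_n(R)\to S_R(n,d):=\mathrm{End}_{RS_d}\big((R^n)^{\otimes d}\big),\qquad \psi\colon RS_d\to \mathrm{End}_{RGL_n(R)}\big((R^n)^{\otimes d}\big).$$ One says that Schur–Weyl duality holds if both $\rho$ and $\psi$ are surjective. Suppose that $R$ contains a set $S$ (finite or infinite) with $|S|>d$ such that $x-y$ is a unit of $R$ for all $x,y\in S$ with $x\neq y$. Then $\rho$ is surjective and, moreover, Schur–Weyl duality holds, that is, $\rho$ and $\psi$ are both surjective. -/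

import Mathlib

open scoped TensorProduct

noncomputable section

namespace SchurWeyl

/-- The `d`-th tensor power of the free module `R^n`. -/
abbrev TensorPower (R : Type*) [CommRing R] (n d : ℕ) : Type _ :=
  ⨂[R] (_ : Fin d), (Fin n → R)

/-- The action of the symmetric group `S_d` on the `d`-th tensor power of `R^n` by place
permutation, `σ (v_1 ⊗ ⋯ ⊗ v_d) = v_{σ⁻¹ 1} ⊗ ⋯ ⊗ v_{σ⁻¹ d}`. -/
def permRep (R : Type*) [CommRing R] (n d : ℕ) :
    Representation R (Equiv.Perm (Fin d)) (TensorPower R n d) where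
  toFun σ := (PiTensorProduct.reindex R (fun _ : Fin d => Fin n → R) σ).toLinearMap
  map_one' := by
    ext v
    simp
    rfl
  map_mul' σ τ := by
    ext v
    simp
    rfl

theorem permRep_tprod (R : Type*) [CommRing R] (n d : ℕ) (σ : Equiv.Perm (Fin d))
    (v : Fin d → Fin n → R) :
    permRep R n d σ (PiTensorProduct.tprod R v) =
      PiTensorProduct.tprod R (fun i => v (σ⁻¹ i)) := by
  simp [permRep, Equiv.Perm.inv_def]

/-- The diagonal action of `GL_n(R)` on the `d`-th tensor power of `R^n`,
`g (v_1 ⊗ ⋯ ⊗ v_d) = g v_1 ⊗ ⋯ ⊗ g v_d`. -/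
def glRep (R : Type*) [CommRing R] (n d : ℕ) :
    Representation R (Matrix.GeneralLinearGroup (Fin n) R) (TensorPower R n d) where
  toFun g := PiTensorProduct.map (fun _ : Fin d => (g : Matrix (Fin n) (Fin n) R).mulVecLin)
  map_one' := by
    ext v
    simp
  map_mul' g h := by
    ext v
    simp

theorem glRep_tprod (R : Type*) [CommRing R] (n d : ℕ)
    (g : Matrix.GeneralLinearGroup (Fin n) R) (v : Fin d → Fin n → R) :
    glRep R n d g (PiTensorProduct.tprod R v) =
      PiTensorProduct.tprod R
        (fun i => Matrix.mulVec (g : Matrix (Fin n) (Fin n) R) (v i)) := by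
  simp [glRep]

/-- For a representation `π` of a group `G` on an `R`-module `M`, the algebra `End_{RG}(M)`, as a
subalgebra of `End_R(M)`: the `R`-linear endomorphisms of `M` that commute with the action of
every element of the group algebra `RG`. -/
def equivariantEnd {R G M : Type*} [CommRing R] [Group G] [AddCommGroup M] [Module R M]
    (π : Representation R G M) : Subalgebra R (Module.End R M) :=
  Subalgebra.centralizer R (Set.range π.asAlgebraHom)

theorem mem_equivariantEnd {R G M : Type*} [CommRing R] [Group G] [AddCommGroup M] [Module R M]
    (π : Representation R G M) (f : Module.End R M) :
    f ∈ equivariantEnd π ↔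
      ∀ (a : MonoidAlgebra R G) (x : M), f (π.asAlgebraHom a x) = π.asAlgebraHom a (f x) := by
  simp only [equivariantEnd, Subalgebra.mem_centralizer_iff, Set.forall_mem_range,
    LinearMap.ext_iff, Module.End.mul_apply]
  exact forall_congr' fun a => forall_congr' fun x => eq_comm

/-- If two group actions on `M` commute, so do the actions of the group algebras. -/
theorem asAlgebraHom_mem_equivariantEnd {R G H M : Type*} [CommRing R] [Group G] [Group H]
    [AddCommGroup M] [Module R M] (π : Representation R G M) (τ : Representation R H M)
    (h : ∀ g k, Commute (π g) (τ k)) (a : MonoidAlgebra R G) :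
    π.asAlgebraHom a ∈ equivariantEnd τ := by
  rw [equivariantEnd, Subalgebra.mem_centralizer_iff]
  rintro _ ⟨b, rfl⟩
  change Commute (τ.asAlgebraHom b) (π.asAlgebraHom a)
  induction b using MonoidAlgebra.induction_linear with
  | zero => simp
  | add f g hf hg => rw [map_add]; exact hf.add_left hg
  | single k r =>
    induction a using MonoidAlgebra.induction_linear with
    | zero => simp
    | add f g hf hg => rw [map_add]; exact hf.add_right hg
    | single g s =>
      rw [Representation.asAlgebraHom_single, Representation.asAlgebraHom_single]
      exact ((h g k).symm.smul_left r).smul_right s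

theorem commute_glRep_permRep (R : Type*) [CommRing R] (n d : ℕ)
    (g : Matrix.GeneralLinearGroup (Fin n) R) (σ : Equiv.Perm (Fin d)) :
    Commute (glRep R n d g) (permRep R n d σ) := by
  change _ = _
  ext v
  simp [glRep_tprod, permRep_tprod]

/-- The Schur algebra `S_R(n, d) = End_{R S_d}((R^n)^{⊗ d})`. -/
def schurAlgebra (R : Type*) [CommRing R] (n d : ℕ) :
    Subalgebra R (Module.End R (TensorPower R n d)) :=
  equivariantEnd (permRep R n d)

/-- The algebra homomorphism `ρ : R GL_n(R) → S_R(n, d)`. -/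
def rho (R : Type*) [CommRing R] (n d : ℕ) :
    MonoidAlgebra R (Matrix.GeneralLinearGroup (Fin n) R) →ₐ[R] schurAlgebra R n d :=
  (glRep R n d).asAlgebraHom.codRestrict (schurAlgebra R n d)
    (asAlgebraHom_mem_equivariantEnd _ _ (commute_glRep_permRep R n d))

/-- The algebra homomorphism `ψ : R S_d → End_{R GL_n(R)}((R^n)^{⊗ d})`. -/
def psi (R : Type*) [CommRing R] (n d : ℕ) :
    MonoidAlgebra R (Equiv.Perm (Fin d)) →ₐ[R] equivariantEnd (glRep R n d) :=
  (permRep R n d).asAlgebraHom.codRestrict (equivariantEnd (glRep R n d))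
    (asAlgebraHom_mem_equivariantEnd _ _ fun σ g => (commute_glRep_permRep R n d g σ).symm)

/-- Schur–Weyl duality holds for `(R^n)^{⊗ d}`: both `ρ` and `ψ` are surjective. -/
def SchurWeylDuality (R : Type*) [CommRing R] (n d : ℕ) : Prop :=
  Function.Surjective (rho R n d) ∧ Function.Surjective (psi R n d)

end SchurWeyl

end

noncomputable section

namespace SchurWeyl

open Finset

/-! In the standard basis, endomorphisms of the tensor power are matrices indexed by words, and the
Schur algebra consists of the place-invariant ones, which are spanned by the indicators of the
orbits of pairs of words.

For `rho`, let `B` be a subalgebra containing the Kronecker powers of all invertible matrices.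
Expanding the Kronecker powers of transvections in the parameter and inverting a Vandermonde matrix
on `d + 1` elements of `S` puts the divided powers of `E_ab`, `a ≠ b`, into `B`
(`dividedPower_mem`); diagonal matrices give the weight projections (`weightProj_mem`). These
generate all orbit matrices, by induction on the number of positions where the two words differ:
multiplying by a divided power creates the required pairs `(a, b)` out of pairs `(b, b)`, up to
orbits with fewer differences (`orbitMatrix_mem`).

For `psi`, surjectivity of `rho` reduces the claim to a statement over any commutative ring: a
matrix commuting with all place-invariant matrices lies in the span of the place permutations
(`mem_placeSpan_of_commute`). Such a matrix is zero once its entries at pairs of lattice words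
vanish (`eq_zero_of_commute`), and those at pairs of different content vanish anyway. Pairs of equal
content are pairs of standard tableaux of the same shape; for each there is a column
antisymmetrizer, and their entries at these pairs are unitriangular. Subtracting a combination of
them therefore kills the matrix. -/

/-- Words of length `d` in `n` letters; they index the standard basis of `(R^n)^{⊗ d}`. -/
abbrev Word (n d : ℕ) : Type := Fin d → Fin n

/-- Replace the letters of `i` at the positions in `Z` by `a`. -/
def setOn {n d : ℕ} (i : Word n d) (Z : Finset (Fin d)) (a : Fin n) : Word n d :=
  fun p => if p ∈ Z then a else i p

/-- The `d`-th Kronecker power of a square matrix. -/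
def kroneckerPower {R : Type*} [CommRing R] {n : ℕ} (d : ℕ) (g : Matrix (Fin n) (Fin n) R) :
    Matrix (Word n d) (Word n d) R :=
  Matrix.of fun i j => ∏ p, g (i p) (j p)

/-- The `k`-th divided power of the elementary matrix `E_ab` acting on the tensor power. -/
def dividedPower (R : Type*) [CommRing R] {n d : ℕ} (a b : Fin n) (k : ℕ) :
    Matrix (Word n d) (Word n d) R :=
  Matrix.of fun i j => ∑ Z ∈ powersetCard k univ,
    if ∀ p, if p ∈ Z then i p = a ∧ j p = b else i p = j p then 1 else 0

/-- Matrices that are invariant under simultaneous permutation of the positions. -/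
def IsPlaceInvariant {R : Type*} {n d : ℕ} (K : Matrix (Word n d) (Word n d) R) : Prop :=
  ∀ (σ : Equiv.Perm (Fin d)) (i j : Word n d), K (i ∘ σ) (j ∘ σ) = K i j

/-- The number of positions at which the pair of words `(i, j)` has the pair of letters `(a, b)`. -/
def pairCount {n d : ℕ} (i j : Word n d) : Fin n → Fin n → ℕ :=
  fun a b => #{p | i p = a ∧ j p = b}

/-- The indicator matrix of an orbit of pairs of words. -/
def orbitMatrix (R : Type*) [CommRing R] {n d : ℕ} (O : Fin n → Fin n → ℕ) :
    Matrix (Word n d) (Word n d) R :=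
  Matrix.of fun i j => if pairCount i j = O then 1 else 0

/-! ### Divided powers, place-invariant matrices and Vandermonde inversion. -/

section DividedPowers

variable {R : Type*} [CommRing R] {n d : ℕ}

theorem setOn_left_iff {a b : Fin n} {i j : Word n d} {Z : Finset (Fin d)} :
    (∀ p, if p ∈ Z then i p = a ∧ j p = b else i p = j p) ↔
      (∀ p ∈ Z, i p = a) ∧ j = setOn i Z b := by
  simp only [funext_iff, setOn]
  constructor
  · intro h
    refine ⟨fun p hp => ?_, fun p => ?_⟩
    · have := h p; simp only [hp, if_true] at this; exact this.1
    · have := h p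
      split_ifs at this ⊢
      exacts [this.2, this.symm]
  · rintro ⟨h, h'⟩ p
    have := h' p
    split_ifs at this ⊢ with hp
    exacts [⟨h p hp, this⟩, this.symm]

theorem setOn_right_iff {a b : Fin n} {i j : Word n d} {Z : Finset (Fin d)} :
    (∀ p, if p ∈ Z then i p = a ∧ j p = b else i p = j p) ↔
      (∀ p ∈ Z, j p = b) ∧ i = setOn j Z a := by
  rw [← setOn_left_iff]
  refine forall_congr' fun p => ?_
  split_ifs
  exacts [and_comm, eq_comm]

theorem powersetCard_filter_univ {α : Type*} [Fintype α] (k : ℕ) (q : α → Prop)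
    [DecidablePred q] :
    powersetCard k (univ.filter q) = (powersetCard k univ).filter fun Z => ∀ p ∈ Z, q p := by
  ext Z
  simp [mem_powersetCard, subset_iff, and_comm]

theorem dividedPower_mul_apply (a b : Fin n) (k : ℕ) (T : Matrix (Word n d) (Word n d) R)
    (i j : Word n d) :
    (dividedPower R (d := d) a b k * T) i j =
      ∑ Z ∈ powersetCard k (univ.filter fun p => i p = a), T (setOn i Z b) j := by
  simp only [Matrix.mul_apply, dividedPower, Matrix.of_apply, sum_mul]
  rw [sum_comm, powersetCard_filter_univ, sum_filter]
  refine sum_congr rfl fun Z _ => ?_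
  simp only [setOn_left_iff]
  split_ifs with h
  · simp only [ite_and, if_pos h]
    simp
  · simp [h]

theorem mul_dividedPower_apply (a b : Fin n) (k : ℕ) (T : Matrix (Word n d) (Word n d) R)
    (i j : Word n d) :
    (T * dividedPower R (d := d) a b k) i j =
      ∑ Z ∈ powersetCard k (univ.filter fun p => j p = b), T i (setOn j Z a) := by
  simp only [Matrix.mul_apply, dividedPower, Matrix.of_apply, mul_sum]
  rw [sum_comm, powersetCard_filter_univ, sum_filter]
  refine sum_congr rfl fun Z _ => ?_
  simp only [setOn_right_iff]
  split_ifs with h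
  · simp only [ite_and, if_pos h]
    simp
  · simp [h]

theorem isPlaceInvariant_dividedPower (a b : Fin n) (k : ℕ) :
    IsPlaceInvariant (dividedPower R (d := d) a b k) := by
  intro σ i j
  simp only [dividedPower, Matrix.of_apply]
  refine sum_equiv (Equiv.finsetCongr σ) (fun Z => ?_) fun Z _ => ?_
  · simp [mem_powersetCard]
  · congr 1
    rw [eq_iff_iff]
    refine σ.forall_congr fun p => ?_
    simp

theorem IsPlaceInvariant.mul {K L : Matrix (Word n d) (Word n d) R} (hK : IsPlaceInvariant K)
    (hL : IsPlaceInvariant L) : IsPlaceInvariant (K * L) := by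
  intro σ i j
  simp only [Matrix.mul_apply]
  refine sum_equiv (σ.arrowCongr (Equiv.refl _)) (fun _ => by simp) fun l _ => ?_
  rw [← hK σ i, ← hL σ _ j]
  congr 2 <;> · funext p; simp

theorem IsPlaceInvariant.sub {K L : Matrix (Word n d) (Word n d) R} (hK : IsPlaceInvariant K)
    (hL : IsPlaceInvariant L) : IsPlaceInvariant (K - L) := by
  intro σ i j
  simp [hK σ i j, hL σ i j]

theorem pairCount_comp (i j : Word n d) (σ : Equiv.Perm (Fin d)) :
    pairCount (i ∘ σ) (j ∘ σ) = pairCount i j := by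
  funext a b
  exact card_equiv σ (by simp)

theorem isPlaceInvariant_orbitMatrix (O : Fin n → Fin n → ℕ) :
    IsPlaceInvariant (orbitMatrix R (d := d) O) := by
  intro σ i j
  simp [orbitMatrix, pairCount_comp]

theorem exists_perm_comp_eq {α β : Type*} [Fintype α] [DecidableEq β] (f g : α → β)
    (h : ∀ c, #{p | f p = c} = #{p | g p = c}) : ∃ σ : Equiv.Perm α, g ∘ σ = f := by
  have e : ∀ c, {p // f p = c} ≃ {p // g p = c} := fun c =>
    Fintype.equivOfCardEq (by rw [Fintype.card_subtype, Fintype.card_subtype, h c])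
  exact ⟨Equiv.ofFiberEquiv e, funext fun p => Equiv.ofFiberEquiv_map e p⟩

/-- The pair counts are a complete invariant of the orbits of place permutations on pairs of words.
-/
theorem IsPlaceInvariant.eq_of_pairCount_eq {α : Type*} {K : Matrix (Word n d) (Word n d) α}
    (hK : IsPlaceInvariant K) {i j i' j' : Word n d} (h : pairCount i j = pairCount i' j') :
    K i j = K i' j' := by
  obtain ⟨σ, hσ⟩ := exists_perm_comp_eq (fun p => (i p, j p)) (fun p => (i' p, j' p)) (by
    rintro ⟨a, b⟩
    simpa [pairCount] using congrFun (congrFun h a) b)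
  have h1 : i' ∘ σ = i := funext fun p => congrArg Prod.fst (congrFun hσ p)
  have h2 : j' ∘ σ = j := funext fun p => congrArg Prod.snd (congrFun hσ p)
  rw [← h1, ← h2, hK]

theorem IsPlaceInvariant.mem_of_orbitMatrix_mem {K : Matrix (Word n d) (Word n d) R}
    (hK : IsPlaceInvariant K) (B : Submodule R (Matrix (Word n d) (Word n d) R))
    (h : ∀ i j, K i j ≠ 0 → orbitMatrix R (pairCount i j) ∈ B) : K ∈ B := by
  classical
  let f : Word n d × Word n d → Fin n → Fin n → ℕ := fun x => pairCount x.1 x.2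
  -- The common value of `K` on the orbit `O`, read off at an arbitrary representative.
  let c : (Fin n → Fin n → ℕ) → R := fun O =>
    if h : ∃ x, f x = O then K h.choose.1 h.choose.2 else 0
  have hc : ∀ i j, c (pairCount i j) = K i j := fun i j => by
    have hx : ∃ x, f x = pairCount i j := ⟨(i, j), rfl⟩
    simp only [c, dif_pos hx]
    exact hK.eq_of_pairCount_eq hx.choose_spec
  have : K = ∑ O ∈ univ.image f, c O • orbitMatrix R O := by
    ext i j
    rw [Matrix.sum_apply, sum_eq_single (pairCount i j)]
    · simp [orbitMatrix, hc]
    · intro O _ hO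
      simp [orbitMatrix, hO.symm]
    · intro hO
      exact absurd (mem_image_of_mem f (mem_univ (i, j))) hO
  rw [this]
  refine B.sum_mem fun O hO => ?_
  obtain ⟨⟨i, j⟩, -, rfl⟩ := mem_image.1 hO
  by_cases h0 : K i j = 0
  · simp [f, hc, h0]
  · exact B.smul_mem _ (h i j h0)

/-- The Vandermonde determinant is a product of differences, hence a unit; its inverse extracts the
coefficients of a polynomial from its values. -/
theorem mem_of_vandermonde {N : Type*} [AddCommGroup N] [Module R N] (B : Submodule R N) {m : ℕ}
    (x : Fin m → R) (hx : ∀ i j, i ≠ j → IsUnit (x i - x j)) (v : Fin m → N)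
    (h : ∀ i, ∑ k : Fin m, x i ^ (k : ℕ) • v k ∈ B) (k : Fin m) : v k ∈ B := by
  have hdet : IsUnit (Matrix.vandermonde x).det := by
    rw [Matrix.det_vandermonde, IsUnit.prod_univ_iff]
    intro i
    rw [IsUnit.prod_iff]
    exact fun j hj => hx j i (ne_of_gt (mem_Ioi.1 hj))
  have hinv := Matrix.nonsing_inv_mul _ hdet
  have key : v k = ∑ i, (Matrix.vandermonde x)⁻¹ k i • ∑ l : Fin m, x i ^ (l : ℕ) • v l := by
    simp only [smul_sum, smul_smul]
    rw [sum_comm]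
    simp only [← sum_smul]
    have : ∀ l : Fin m, ∑ i, (Matrix.vandermonde x)⁻¹ k i * x i ^ (l : ℕ) =
        (1 : Matrix (Fin m) (Fin m) R) k l := fun l => by
      rw [← hinv, Matrix.mul_apply]
      simp [Matrix.vandermonde_apply]
    simp [this, Matrix.one_apply]
  rw [key]
  exact B.sum_mem fun i _ => B.smul_mem _ (h i)

end DividedPowers

/-! ### Kronecker powers of invertible matrices generate all place-invariant matrices. -/

section Generation

variable {R : Type*} [CommRing R] {n d : ℕ}

theorem kroneckerPower_transvection {a b : Fin n} (x : R) :
    kroneckerPower d (Matrix.transvection a b x) =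
      ∑ k : Fin (d + 1), x ^ (k : ℕ) • dividedPower R a b (k : ℕ) := by
  ext i j
  rw [Matrix.sum_apply]
  have h1 : ∀ p, Matrix.transvection a b x (i p) (j p) =
      (if i p = a ∧ j p = b then x else 0) + (if i p = j p then 1 else 0) := fun p => by
    simp [Matrix.transvection, Matrix.one_apply, Matrix.single_apply, add_comm, eq_comm]
  simp only [kroneckerPower, Matrix.of_apply, h1, prod_add]
  rw [sum_powerset, card_univ, Fintype.card_fin, sum_range]
  refine sum_congr rfl fun k _ => ?_
  simp only [Matrix.smul_apply, dividedPower, Matrix.of_apply, smul_sum]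
  refine sum_congr rfl fun Z hZ => ?_
  rw [prod_ite_zero, prod_ite_zero]
  simp only [prod_const, one_pow, (mem_powersetCard.1 hZ).2]
  have key : (∀ p, if p ∈ Z then i p = a ∧ j p = b else i p = j p) ↔
      (∀ p ∈ Z, i p = a ∧ j p = b) ∧ ∀ p ∈ univ \ Z, i p = j p := by
    simp only [mem_sdiff, mem_univ, true_and, ← forall_and]
    refine forall_congr' fun p => ?_
    by_cases hp : p ∈ Z <;> simp [hp]
  simp only [key]
  split_ifs <;> simp_all

/-- The projection onto the span of the words with exactly `k` letters `a`. -/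
def letterProj (R : Type*) [CommRing R] {n d : ℕ} (a : Fin n) (k : ℕ) :
    Matrix (Word n d) (Word n d) R :=
  Matrix.diagonal fun i => if #{p | i p = a} = k then 1 else 0

theorem kroneckerPower_diagonal_update (a : Fin n) (x : R) :
    kroneckerPower d (Matrix.diagonal (Function.update 1 a x)) =
      ∑ k : Fin (d + 1), x ^ (k : ℕ) • letterProj R a (k : ℕ) := by
  ext i j
  rw [Matrix.sum_apply]
  simp only [kroneckerPower, Matrix.of_apply, letterProj, Matrix.smul_apply]
  by_cases hij : i = j
  · subst hij
    have hlt : #{p | i p = a} < d + 1 :=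
      Nat.lt_succ_of_le (by simpa using card_le_univ {p | i p = a})
    rw [sum_eq_single ⟨_, hlt⟩]
    · simp [Function.update_apply, prod_ite]
    · intro k _ hk
      have : #{p | i p = a} ≠ k := fun h => hk (Fin.ext h.symm)
      simp [this]
    · simp
  · obtain ⟨p, hp⟩ := Function.ne_iff.1 hij
    rw [prod_eq_zero (mem_univ p) (by simp [hp])]
    simp [Matrix.diagonal_apply_ne _ hij]

theorem dividedPower_length_apply (a b : Fin n) (i j : Word n d) :
    dividedPower R a b d i j = if (∀ p, i p = a) ∧ ∀ p, j p = b then 1 else 0 := by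
  have : powersetCard d (univ : Finset (Fin d)) = {univ} := by
    simpa using powersetCard_self (univ : Finset (Fin d))
  simp only [dividedPower, Matrix.of_apply, this, sum_singleton, mem_univ, if_true, forall_and]

/-- The only nonzero path from the constant word `a` to itself passes through the constant word `b`.
-/
theorem letterProj_length {a b : Fin n} :
    letterProj R (d := d) a d = dividedPower R a b d * dividedPower R b a d := by
  have hcard : ∀ i : Word n d, #{p | i p = a} = d ↔ ∀ p, i p = a := fun i => by
    have := card_filter_eq_iff (s := (univ : Finset (Fin d))) (p := fun p => i p = a)
    simpa using this
  ext i j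
  rw [Matrix.mul_apply, sum_eq_single (fun _ => b)]
  · simp only [dividedPower_length_apply, letterProj, Matrix.diagonal_apply, hcard]
    by_cases hi : ∀ p, i p = a
    · by_cases hj : ∀ p, j p = a
      · have : i = j := funext fun p => (hi p).trans (hj p).symm
        simp [this, hj]
      · have : i ≠ j := fun h => hj (h ▸ hi)
        simp [this, hj]
    · simp [hi]
  · intro l _ hl
    have : ¬ ∀ p, l p = b := fun h => hl (funext h)
    simp [dividedPower_length_apply, this]
  · simp

theorem dividedPower_mem {B : Subalgebra R (Matrix (Word n d) (Word n d) R)}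
    (hB : ∀ g : Matrix (Fin n) (Fin n) R, IsUnit g.det → kroneckerPower d g ∈ B)
    {s : Fin (d + 1) → R} (hs : ∀ i j, i ≠ j → IsUnit (s i - s j))
    {a b : Fin n} (hab : a ≠ b) (k : ℕ) : dividedPower R a b k ∈ B := by
  by_cases hk : k < d + 1
  · refine mem_of_vandermonde (Subalgebra.toSubmodule B) s hs
      (fun k : Fin (d + 1) => dividedPower R a b (k : ℕ)) (fun i => ?_) ⟨k, hk⟩
    rw [← kroneckerPower_transvection]
    exact hB _ (by simp [Matrix.det_transvection_of_ne _ _ hab])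
  · have : dividedPower R (d := d) a b k = 0 := by
      ext i j
      simp only [dividedPower, Matrix.of_apply, Matrix.zero_apply]
      rw [powersetCard_eq_empty.2 (by simpa using hk), sum_empty]
    rw [this]
    exact B.zero_mem

theorem letterProj_mem {B : Subalgebra R (Matrix (Word n d) (Word n d) R)}
    (hB : ∀ g : Matrix (Fin n) (Fin n) R, IsUnit g.det → kroneckerPower d g ∈ B)
    {s : Fin (d + 1) → R} (hs : ∀ i j, i ≠ j → IsUnit (s i - s j))
    (a : Fin n) (k : ℕ) : letterProj R a k ∈ B := by
  have htop : letterProj R (d := d) a d ∈ B := by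
    by_cases h : ∃ b, a ≠ b
    · obtain ⟨b, hab⟩ := h
      rw [letterProj_length (b := b)]
      exact B.mul_mem (dividedPower_mem hB hs hab d) (dividedPower_mem hB hs hab.symm d)
    -- There is only one letter, so every word consists of `d` letters `a`.
    · push Not at h
      have : letterProj R (d := d) a d = 1 := by
        rw [letterProj, ← Matrix.diagonal_one]
        congr 1
        funext i
        simp [← h]
      rw [this]
      exact B.one_mem
  rcases lt_trichotomy k d with hk | rfl | hk
  -- The diagonal matrices must be invertible, and the differences `s i.succ - s 0` supply only `d`
  -- suitable parameters. This is enough because the top coefficient is already known to lie in `B`.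
  · refine mem_of_vandermonde (Subalgebra.toSubmodule B) (fun i : Fin d => s i.succ - s 0)
      (fun i j hij => ?_) (fun k : Fin d => letterProj R a (k : ℕ)) (fun i => ?_) ⟨k, hk⟩
    · rw [sub_sub_sub_cancel_right]
      exact hs _ _ (by simpa using hij)
    · have h1 := kroneckerPower_diagonal_update (d := d) a (s i.succ - s 0)
      rw [Fin.sum_univ_castSucc] at h1
      have h2 := sub_eq_of_eq_add h1
      simp only [Fin.val_castSucc, Fin.val_last] at h2
      rw [← h2]
      refine B.sub_mem (hB _ ?_) (B.smul_mem htop _)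
      rw [Matrix.det_diagonal, prod_update_of_mem (mem_univ a)]
      simpa using hs i.succ 0 (Fin.succ_ne_zero i)
  · exact htop
  · have : letterProj R (d := d) a k = 0 := by
      rw [letterProj, ← Matrix.diagonal_zero]
      congr 1
      funext i
      have : #{p | i p = a} ≤ d := by simpa using card_le_univ {p | i p = a}
      rw [if_neg (by omega)]
    rw [this]
    exact B.zero_mem

theorem weightProj_mem {B : Subalgebra R (Matrix (Word n d) (Word n d) R)}
    (hB : ∀ g : Matrix (Fin n) (Fin n) R, IsUnit g.det → kroneckerPower d g ∈ B)
    {s : Fin (d + 1) → R} (hs : ∀ i j, i ≠ j → IsUnit (s i - s j))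
    (A : Finset (Fin n)) (w : Fin n → ℕ) :
    Matrix.diagonal (fun i : Word n d => if ∀ a ∈ A, #{p | i p = a} = w a then (1 : R) else 0) ∈
      B := by
  induction A using Finset.induction_on with
  | empty => simp
  | insert a A _ ih =>
    convert B.mul_mem (letterProj_mem hB hs a (w a)) ih using 1
    rw [letterProj, Matrix.diagonal_mul_diagonal]
    congr 1
    funext i
    simp only [forall_mem_insert, ite_and, mul_ite, mul_one, mul_zero]
    split_ifs <;> rfl

/-- The effect on pair counts of changing the first letter of every pair `(a, b)` to `b`. -/
def movePair {n : ℕ} (a b : Fin n) (O : Fin n → Fin n → ℕ) : Fin n → Fin n → ℕ :=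
  fun x y => if y = b then (if x = a then 0 else if x = b then O b b + O a b else O x y) else O x y

theorem pairCount_setOn {a b : Fin n} (hab : a ≠ b) (i j : Word n d) :
    pairCount (setOn i {p | i p = a ∧ j p = b} b) j = movePair a b (pairCount i j) := by
  funext x y
  simp only [pairCount, movePair]
  by_cases hy : y = b
  · subst hy
    rw [if_pos rfl]
    by_cases hxa : x = a
    · subst hxa
      rw [if_pos rfl, card_eq_zero, filter_eq_empty_iff]
      intro p _
      simp only [setOn, mem_filter, mem_univ, true_and]
      split_ifs with h
      · simp [hab.symm]
      · exact h
    · rw [if_neg hxa]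
      by_cases hxb : x = y
      · subst hxb
        rw [if_pos rfl, ← card_union_of_disjoint]
        · congr 1
          ext p
          simp only [setOn, mem_filter, mem_univ, true_and, mem_union]
          split_ifs with h <;> grind
        · rw [disjoint_filter]
          grind
      · rw [if_neg hxb]
        congr 1
        ext p
        simp only [setOn, mem_filter, mem_univ, true_and]
        split_ifs with h <;> grind
  · rw [if_neg hy]
    congr 1
    ext p
    simp only [setOn, mem_filter, mem_univ, true_and]
    split_ifs with h <;> grind

theorem movePair_injective {a b : Fin n} (hab : a ≠ b) {O O' : Fin n → Fin n → ℕ}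
    (h : movePair a b O = movePair a b O') (h' : O a b = O' a b) : O = O' := by
  funext x y
  have hxy := congrFun (congrFun h x) y
  have hbb := congrFun (congrFun h b) b
  simp only [movePair, if_true, if_neg hab.symm] at hxy hbb
  grind

theorem card_ne_eq_of_pairCount_eq {i j i' j' : Word n d} (h : pairCount i j = pairCount i' j') :
    #{p | i p ≠ j p} = #{p | i' p ≠ j' p} :=
  IsPlaceInvariant.eq_of_pairCount_eq (K := Matrix.of fun i j : Word n d => #{p | i p ≠ j p})
    (fun σ i j => by
      simp only [Matrix.of_apply]
      exact card_equiv σ (by simp)) h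

/-- Changing `#Z` letters removes at most `#Z` differences, and fewer if some changed letter does
not match `j`. The bound `hle` forces every change to remove one, so `Z` meets only pairs `(a, b)`;
no such pair may survive, so `Z` contains them all. -/
theorem eq_filter_of_pairCount_setOn_eq {a b : Fin n} (hab : a ≠ b) {i j i₀ j₀ : Word n d}
    (hle : #{p | i₀ p ≠ j₀ p} ≤ #{p | i p ≠ j p}) {Z : Finset (Fin d)} (hZ : ∀ p ∈ Z, i p = a)
    (hcard : #Z = pairCount i₀ j₀ a b)
    (h : pairCount (setOn i Z b) j = movePair a b (pairCount i₀ j₀)) :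
    Z = univ.filter fun p => i p = a ∧ j p = b := by
  have h0 : #{p | setOn i Z b p ≠ j p} + #Z = #{p | i₀ p ≠ j₀ p} := by
    rw [card_ne_eq_of_pairCount_eq (h.trans (pairCount_setOn hab i₀ j₀).symm), hcard, pairCount,
      ← card_union_of_disjoint]
    · congr 1
      ext p
      simp only [setOn, mem_filter, mem_univ, true_and, mem_union]
      split_ifs with h <;> grind
    · rw [disjoint_filter]
      intro p _
      simp only [setOn, mem_filter, mem_univ, true_and]
      split_ifs with h <;> grind
  have h1 : #{p | i p ≠ j p} + #(Z.filter fun p => j p ≠ b) ≤ #{p | setOn i Z b p ≠ j p} + #Z := by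
    rw [← card_union_add_card_inter (univ.filter fun p => setOn i Z b p ≠ j p) Z]
    refine Nat.add_le_add (card_le_card fun p => ?_) (card_le_card fun p => ?_)
    · simp only [mem_filter, mem_univ, true_and, mem_union]
      simp only [setOn]
      grind
    · simp only [mem_filter, mem_inter, setOn]
      grind
  have h2 : #(Z.filter fun p => j p ≠ b) = 0 := by omega
  rw [card_eq_zero, filter_eq_empty_iff] at h2
  have h3 := congrFun (congrFun h a) b
  simp only [pairCount, movePair, ↓reduceIte, card_eq_zero, filter_eq_empty_iff] at h3
  ext p
  simp only [mem_filter, mem_univ, true_and]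
  refine ⟨fun hp => ⟨hZ p hp, by simpa using h2 hp⟩, fun ⟨hp, hp'⟩ => ?_⟩
  by_contra hpZ
  exact h3 (mem_univ p) (by simp [setOn, hpZ, hp, hp'])

/-- Leading term of the product: among pairs with at least as many differences as `(i₀, j₀)`, only
the orbit of `(i₀, j₀)` contributes, through a single set `Z`. -/
theorem dividedPower_mul_orbitMatrix_apply {a b : Fin n} (hab : a ≠ b) {i j i₀ j₀ : Word n d}
    (hle : #{p | i₀ p ≠ j₀ p} ≤ #{p | i p ≠ j p}) :
    (dividedPower R (d := d) a b (pairCount i₀ j₀ a b) *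
      orbitMatrix R (d := d) (movePair a b (pairCount i₀ j₀))) i j =
      orbitMatrix R (pairCount i₀ j₀) i j := by
  rw [dividedPower_mul_apply]
  simp only [orbitMatrix, Matrix.of_apply]
  have key : ∀ Z ∈ powersetCard (pairCount i₀ j₀ a b) (univ.filter fun p => i p = a),
      pairCount (setOn i Z b) j = movePair a b (pairCount i₀ j₀) →
        Z = (univ.filter fun p => i p = a ∧ j p = b) ∧ pairCount i j = pairCount i₀ j₀ := by
    intro Z hZ h
    obtain ⟨hsub, hcard⟩ := mem_powersetCard.1 hZ
    have hZe := eq_filter_of_pairCount_setOn_eq hab hle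
      (fun p hp => (mem_filter.1 (hsub hp)).2) hcard h
    refine ⟨hZe, movePair_injective hab ?_ ?_⟩
    · rw [← h, hZe, pairCount_setOn hab]
    · rw [← hcard, hZe]
      rfl
  by_cases hO : pairCount i j = pairCount i₀ j₀
  · rw [if_pos hO, sum_eq_single (univ.filter fun p => i p = a ∧ j p = b)]
    · rw [pairCount_setOn hab, hO, if_pos rfl]
    · intro Z hZ hne
      rw [if_neg fun h => hne (key Z hZ h).1]
    · intro h
      refine absurd (mem_powersetCard.2 ⟨fun p hp => ?_, ?_⟩) h
      · simp only [mem_filter, mem_univ, true_and] at hp ⊢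
        exact hp.1
      · rw [← hO]
        rfl
  · rw [if_neg hO]
    exact sum_eq_zero fun Z hZ => if_neg fun h => hO (key Z hZ h).2

theorem orbitMatrix_mem {B : Subalgebra R (Matrix (Word n d) (Word n d) R)}
    (hB : ∀ g : Matrix (Fin n) (Fin n) R, IsUnit g.det → kroneckerPower d g ∈ B)
    {s : Fin (d + 1) → R} (hs : ∀ i j, i ≠ j → IsUnit (s i - s j)) (i₀ j₀ : Word n d) :
    orbitMatrix R (pairCount i₀ j₀) ∈ B := by
  induction hm : #{p | i₀ p ≠ j₀ p} using Nat.strong_induction_on generalizing i₀ j₀ with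
  | _ m ih =>
  by_cases h0 : ∃ p, i₀ p ≠ j₀ p
  · obtain ⟨p, hp⟩ := h0
    set O := pairCount i₀ j₀
    have hZ : (0 : ℕ) < O (i₀ p) (j₀ p) := card_pos.2 ⟨p, by simp⟩
    have hlt : ∀ i j : Word n d, pairCount i j = movePair (i₀ p) (j₀ p) O →
        #{p | i p ≠ j p} < m := by
      intro i j h
      rw [card_ne_eq_of_pairCount_eq (h.trans (pairCount_setOn hp i₀ j₀).symm), ← hm]
      refine card_lt_card ?_
      rw [ssubset_iff_of_subset]
      · exact ⟨p, by simpa using hp, by simp [setOn]⟩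
      · intro q
        simp only [setOn, mem_filter, mem_univ, true_and]
        split_ifs with h <;> grind
    have hprod : dividedPower R (i₀ p) (j₀ p) (O (i₀ p) (j₀ p)) *
        orbitMatrix R (movePair (i₀ p) (j₀ p) O) ∈ B := by
      refine B.mul_mem (dividedPower_mem hB hs hp _) ?_
      rw [← pairCount_setOn hp]
      exact ih _ (hlt _ _ (pairCount_setOn hp i₀ j₀)) _ _ rfl
    have hinv := ((isPlaceInvariant_dividedPower (R := R) (d := d) (i₀ p) (j₀ p)
      (O (i₀ p) (j₀ p))).mul (isPlaceInvariant_orbitMatrix (movePair (i₀ p) (j₀ p) O))).sub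
      (isPlaceInvariant_orbitMatrix O)
    -- The remainder is supported on pairs with fewer than `m` differences, so induction applies to
    -- each of its orbits.
    have hdiff := hinv.mem_of_orbitMatrix_mem (Subalgebra.toSubmodule B) fun i j hij => by
      refine ih _ ?_ i j rfl
      by_contra hge
      refine hij ?_
      rw [Matrix.sub_apply, dividedPower_mul_orbitMatrix_apply hp (by omega), sub_self]
    have := B.sub_mem hprod hdiff
    rwa [sub_sub_cancel] at this
  · push Not at h0
    obtain rfl : i₀ = j₀ := funext h0
    -- Without differences, the orbit matrix is the projection onto a weight space.
    convert weightProj_mem hB hs univ (fun a => pairCount i₀ i₀ a a) using 1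
    ext i j
    rw [orbitMatrix, Matrix.of_apply, Matrix.diagonal_apply]
    by_cases hij : i = j
    · subst hij
      rw [if_pos rfl]
      congr 1
      rw [eq_iff_iff]
      have hoff : ∀ (i : Word n d) (a b : Fin n), a ≠ b → pairCount i i a b = 0 := by
        intro i a b hab
        rw [pairCount, card_eq_zero, filter_eq_empty_iff]
        grind
      have hon : ∀ (i : Word n d) (a : Fin n), pairCount i i a a = #{p | i p = a} := by
        simp [pairCount]
      constructor
      · intro h a _
        rw [← h, hon]
      · intro h
        funext a b
        by_cases hab : a = b
        · subst hab
          rw [← h a (mem_univ a), hon]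
        · rw [hoff _ _ _ hab, hoff _ _ _ hab]
    · rw [if_neg hij, if_neg]
      intro h
      have := card_ne_eq_of_pairCount_eq h
      simp at this
      exact hij (funext this)

theorem IsPlaceInvariant.mem_of_kroneckerPower_mem {K : Matrix (Word n d) (Word n d) R}
    (hK : IsPlaceInvariant K) {B : Subalgebra R (Matrix (Word n d) (Word n d) R)}
    (hB : ∀ g : Matrix (Fin n) (Fin n) R, IsUnit g.det → kroneckerPower d g ∈ B)
    {s : Fin (d + 1) → R} (hs : ∀ i j, i ≠ j → IsUnit (s i - s j)) : K ∈ B :=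
  hK.mem_of_orbitMatrix_mem (Subalgebra.toSubmodule B) fun i j _ => orbitMatrix_mem hB hs i j

end Generation

/-! ### Combinatorics of lattice words and their tableaux. -/

section Words

variable {n d : ℕ}

/-- The sum of the letters of a word. -/
def letterSum (j : Word n d) : ℕ := ∑ p, (j p : ℕ)

/-- The number of earlier occurrences of the letter at position `p`: the column of `p` in the
tableau that is encoded by the word. -/
def column (t : Word n d) (p : Fin d) : ℕ := #{q | q < p ∧ t q = t p}

/-- Lattice words (the words that encode standard tableaux): no initial segment has more letters
`a + 1` than letters `a`. -/
def IsLattice (t : Word n d) : Prop :=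
  ∀ a b : Fin n, (b : ℕ) = a + 1 → ∀ p, #{q | q ≤ p ∧ t q = b} ≤ #{q | q ≤ p ∧ t q = a}

/-- The word `j` is injective on each column of the tableau of `t`. -/
def InjOnColumns (j t : Word n d) : Prop :=
  ∀ p q, column t p = column t q → j p = j q → p = q

theorem letterSum_setOn {a b : Fin n} (hab : (b : ℕ) = a + 1) {i : Word n d} {Z : Finset (Fin d)}
    (hZ : ∀ p ∈ Z, i p = a) : letterSum (setOn i Z b) = letterSum i + #Z := by
  have : ∀ p, (setOn i Z b p : ℕ) = i p + if p ∈ Z then 1 else 0 := by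
    intro p
    simp only [setOn]
    split_ifs with hp
    · rw [hab, hZ p hp]
    · rfl
  simp [letterSum, this, sum_add_distrib]

theorem column_lt_column {t : Word n d} {p q : Fin d} (h : t p = t q) (hpq : p < q) :
    column t p < column t q := by
  refine card_lt_card ?_
  rw [ssubset_iff_of_subset]
  · exact ⟨p, by simp [hpq, h], by simp⟩
  · intro r
    simp only [mem_filter, mem_univ, true_and]
    exact fun ⟨h1, h2⟩ => ⟨h1.trans hpq, h2.trans h⟩

theorem eq_of_column_eq {t : Word n d} {p q : Fin d} (h : t p = t q)
    (hc : column t p = column t q) : p = q := by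
  rcases lt_trichotomy p q with hpq | hpq | hpq
  · exact absurd hc (column_lt_column h hpq).ne
  · exact hpq
  · exact absurd hc (column_lt_column h.symm hpq).ne'

/-- The first occurrences of a letter occupy the columns `0, 1, 2, ...` of its row without gaps. -/
theorem image_column {t : Word n d} {a : Fin n} {S : Finset (Fin d)} (hS : ∀ q ∈ S, t q = a)
    (hdown : ∀ q ∈ S, ∀ r < q, t r = a → r ∈ S) : S.image (column t) = range #S := by
  refine eq_of_subset_of_card_le (fun c hc => ?_) ?_
  · obtain ⟨q, hq, rfl⟩ := mem_image.1 hc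
    rw [mem_range]
    refine card_lt_card ?_
    rw [ssubset_iff_of_subset]
    · exact ⟨q, hq, by simp⟩
    · intro r
      simp only [mem_filter, mem_univ, true_and]
      exact fun ⟨h1, h2⟩ => hdown q hq r h1 (h2.trans (hS q hq))
  · rw [card_range, card_image_of_injOn]
    intro p hp q hq hpq
    exact eq_of_column_eq ((hS p hp).trans (hS q hq).symm) hpq

theorem IsLattice.exists_pred {t : Word n d} (ht : IsLattice t) {a b : Fin n}
    (hab : (b : ℕ) = a + 1) {p : Fin d} (hp : t p = b) :
    ∃ q < p, t q = a ∧ column t q = column t p := by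
  have himg := image_column (t := t) (a := a) (S := univ.filter fun q => q ≤ p ∧ t q = a)
    (by simp) (by
      simp only [mem_filter, mem_univ, true_and]
      exact fun q hq r hr h => ⟨hr.le.trans hq.1, h⟩)
  have hlt : column t p < #{q | q ≤ p ∧ t q = a} := by
    refine lt_of_lt_of_le (card_lt_card ?_) (ht a b hab p)
    rw [ssubset_iff_of_subset]
    · exact ⟨p, by simp [hp], by simp⟩
    · intro r
      simp only [mem_filter, mem_univ, true_and, hp]
      exact fun ⟨h1, h2⟩ => ⟨h1.le, h2⟩
  rw [← mem_range, ← himg, mem_image] at hlt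
  obtain ⟨q, hq, hqc⟩ := hlt
  simp only [mem_filter, mem_univ, true_and] at hq
  refine ⟨q, lt_of_le_of_ne hq.1 ?_, hq.2, hqc⟩
  rintro rfl
  rw [hq.2] at hp
  simp [hp] at hab

/-- Each box of the tableau has above it, in the same column, a box in every smaller row, filled by
an earlier position. -/
theorem IsLattice.exists_of_lt {t : Word n d} (ht : IsLattice t) {a : Fin n} {p : Fin d}
    (hp : a < t p) : ∃ q < p, t q = a ∧ column t q = column t p := by
  induction hk : (t p : ℕ) - a using Nat.strong_induction_on generalizing p with
  | _ k ih =>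
  have hlt : (a : ℕ) < t p := hp
  have hn := (t p).isLt
  obtain ⟨q, hq, hqt, hqc⟩ := ht.exists_pred (a := ⟨t p - 1, by omega⟩) (by simp; omega)
    (rfl : t p = t p)
  have hqv : (t q : ℕ) = t p - 1 := by rw [hqt]
  by_cases haq : a = t q
  · exact ⟨q, hq, haq.symm, hqc⟩
  · have haq' : (a : ℕ) ≠ t q := fun h => haq (Fin.ext h)
    obtain ⟨r, hr, hrt, hrc⟩ := ih _ (by omega) (p := q) (Fin.lt_def.2 (by omega)) rfl
    exact ⟨r, hr.trans hq, hrt, hrc.trans hqc⟩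

theorem toLex_lt_iff {i j : Word n d} :
    toLex i < toLex j ↔ ∃ p, (∀ q < p, i q = j q) ∧ i p < j p := Iff.rfl

/-- At the first difference, if `j p < t p`, the letter `j p` already occurs earlier in the same
column of `t`, where `j` and `t` still agree. This contradicts injectivity. -/
theorem InjOnColumns.toLex_le {j t : Word n d} (h : InjOnColumns j t) (ht : IsLattice t) :
    toLex t ≤ toLex j := by
  by_contra hlt
  obtain ⟨p, hp, hlt⟩ := toLex_lt_iff.1 (not_le.1 hlt)
  obtain ⟨q, hq, hqt, hqc⟩ := ht.exists_of_lt hlt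
  exact hq.ne (h q p hqc ((hp q hq).trans hqt))

/-- On a column, `j` orders any two distinct positions strictly one way, so the count depends only
on the columns and not on `j`. -/
theorem InjOnColumns.two_mul_sum {j t : Word n d} (h : InjOnColumns j t) :
    2 * ∑ p, #{q | column t q = column t p ∧ j q < j p} =
      ∑ p, #{q | column t q = column t p ∧ q ≠ p} := by
  have hcomm : ∑ p, #{q | column t q = column t p ∧ j q < j p} =
      ∑ p, #{q | column t q = column t p ∧ j p < j q} := by
    simp only [card_filter]
    rw [sum_comm]
    simp only [eq_comm]
  rw [two_mul]
  nth_rewrite 2 [hcomm]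
  rw [← sum_add_distrib]
  refine sum_congr rfl fun p _ => ?_
  rw [← card_union_of_disjoint]
  · congr 1
    ext q
    simp only [mem_filter, mem_univ, true_and, mem_union, ← and_or_left, ← ne_iff_lt_or_gt]
    refine and_congr_right fun hc => ⟨fun hj hqp => hj (hqp ▸ rfl), fun hqp hj => hqp (h q p hc hj)⟩
  · rw [disjoint_filter]
    exact fun q _ h1 h2 => lt_asymm h1.2 h2.2

/-- Both letter sums are compared with the number of pairs of boxes sharing a column: `t p` is at
most the number of boxes above `p`, while `j p` bounds the number of smaller distinct letters in the
column. -/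
theorem InjOnColumns.letterSum_le {j t : Word n d} (h : InjOnColumns j t) (ht : IsLattice t) :
    letterSum t ≤ letterSum j := by
  have htt : InjOnColumns t t := fun p q hc hpq => eq_of_column_eq hpq hc
  have h1 : letterSum t ≤ ∑ p, #{q | column t q = column t p ∧ t q < t p} := by
    refine sum_le_sum fun p _ => ?_
    rw [← card_range (t p : ℕ), ← card_image_of_injOn (s := univ.filter fun q =>
      column t q = column t p ∧ t q < t p) (f := fun q => (t q : ℕ))]
    · refine card_le_card fun a ha => ?_
      rw [mem_range] at ha
      obtain ⟨q, -, hqt, hqc⟩ := ht.exists_of_lt (a := ⟨a, ha.trans (t p).isLt⟩) (p := p) ha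
      refine mem_image.2 ⟨q, ?_, by rw [hqt]⟩
      simp only [mem_filter, mem_univ, true_and]
      exact ⟨hqc, hqt ▸ ha⟩
    · intro q hq r hr hqr
      simp only [coe_filter, mem_univ, true_and, Set.mem_ofPred_eq] at hq hr
      exact htt q r (hq.1.trans hr.1.symm) (Fin.ext hqr)
  have h2 : ∑ p, #{q | column t q = column t p ∧ j q < j p} ≤ letterSum j := by
    refine sum_le_sum fun p _ => ?_
    rw [← card_range (j p : ℕ)]
    refine card_le_card_of_injOn (fun q => (j q : ℕ)) (fun q hq => ?_) fun q hq r hr hqr => ?_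
    · simp only [coe_filter, mem_univ, true_and, Set.mem_ofPred_eq] at hq
      simpa using hq.2
    · simp only [coe_filter, mem_univ, true_and, Set.mem_ofPred_eq] at hq hr
      exact h q r (hq.1.trans hr.1.symm) (Fin.ext hqr)
  have h3 := h.two_mul_sum
  have h4 := htt.two_mul_sum
  omega

theorem card_filter_column (t : Word n d) (a : Fin n) (c : ℕ) :
    #{p | t p = a ∧ column t p = c} = if c < #{p | t p = a} then 1 else 0 := by
  have himg := image_column (t := t) (a := a) (S := univ.filter fun q => t q = a)
    (by simp) (by simp)
  split_ifs with hc
  · rw [← mem_range, ← himg, mem_image] at hc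
    obtain ⟨p, hp, rfl⟩ := hc
    rw [card_eq_one]
    refine ⟨p, ?_⟩
    ext q
    simp only [mem_filter, mem_univ, true_and, mem_singleton] at hp ⊢
    exact ⟨fun h => eq_of_column_eq (h.1.trans hp.symm) h.2, by rintro rfl; exact ⟨hp, rfl⟩⟩
  · rw [card_eq_zero, filter_eq_empty_iff]
    rintro p - ⟨hp, rfl⟩
    refine hc ?_
    rw [← mem_range, ← himg]
    exact mem_image_of_mem _ (by simpa using hp)

/-- Words with the same content have the same set of boxes (letter, column); `w` matches positions
in the same box. -/
theorem exists_perm_column {s t : Word n d} (h : ∀ a, #{p | s p = a} = #{p | t p = a}) :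
    ∃ w : Equiv.Perm (Fin d), (∀ p, s (w p) = t p) ∧ ∀ p, column s (w p) = column t p := by
  obtain ⟨w, hw⟩ := exists_perm_comp_eq (fun p => (t p, column t p)) (fun p => (s p, column s p))
    (by
      rintro ⟨a, c⟩
      simp only [Prod.mk.injEq, card_filter_column, h])
  exact ⟨w, fun p => congrArg Prod.fst (congrFun hw p), fun p => congrArg Prod.snd (congrFun hw p)⟩

end Words

/-! ### Straightening: reduction of arbitrary words to lattice words. -/

section Straightening

variable {n d : ℕ} {N : Type*} [AddCommGroup N]

/-- A Garnir-type relation: the positions in `A` are excluded from the choice of `Z`. Moving `x`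
from `A` to `B` adds exactly the sets containing `x`, whose sum is the same kind of relation for the
word with `b` at `x`. -/
theorem sum_powersetCard_setOn_eq_zero {F : Word n d → N} {m : ℕ} {a b : Fin n}
    (hab : (b : ℕ) = a + 1)
    (hF : ∀ i k, 1 ≤ k → letterSum i + k = m →
      ∑ Z ∈ powersetCard k (univ.filter fun p => i p = a), F (setOn i Z b) = 0)
    (A B : Finset (Fin d)) (i : Word n d) (c : ℕ) (hAB : ∀ p, i p = a ↔ p ∈ A ∨ p ∈ B)
    (hdisj : Disjoint A B) (hm : letterSum i + c = m) (hc : #A < c) :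
    ∑ Z ∈ powersetCard c B, F (setOn i Z b) = 0 := by
  have hne : b ≠ a := fun h => by simp [h] at hab
  induction A using Finset.induction_on generalizing B i c with
  | empty =>
    have : B = univ.filter fun p => i p = a := by ext p; simp [hAB]
    rw [this]
    exact hF i c (by rwa [card_empty] at hc) hm
  | insert x A hx ih =>
    rw [disjoint_insert_left] at hdisj
    rw [card_insert_of_notMem hx] at hc
    obtain ⟨c, rfl⟩ : ∃ c', c = c' + 1 := ⟨c - 1, by omega⟩
    have hix : i x = a := (hAB x).2 (Or.inl (mem_insert_self _ _))
    have h1 := ih (insert x B) i (c + 1)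
      (fun p => by rw [hAB, mem_insert, mem_insert]; tauto)
      (disjoint_insert_right.2 ⟨hx, hdisj.2⟩) hm (by omega)
    have h2 := ih B (setOn i {x} b) c (fun p => by
        simp only [setOn, mem_singleton]
        split_ifs with hp
        · subst hp
          simp [hne, hx, hdisj.1]
        · rw [hAB, mem_insert]
          simp [hp]) hdisj.2
      (by rw [letterSum_setOn hab (by simpa using hix), card_singleton]; omega) (by omega)
    rw [powersetCard_succ_insert hdisj.1, sum_union, sum_image] at h1
    · have h3 : ∀ Z, setOn i (insert x Z) b = setOn (setOn i {x} b) Z b := by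
        intro Z
        funext p
        simp only [setOn, mem_insert, mem_singleton]
        grind
      simp only [h3, h2, add_zero] at h1
      exact h1
    · intro Z hZ Z' hZ' h
      have hxZ : x ∉ Z := fun h => hdisj.1 ((mem_powersetCard.1 hZ).1 h)
      have hxZ' : x ∉ Z' := fun h => hdisj.1 ((mem_powersetCard.1 hZ').1 h)
      rw [← erase_insert hxZ, ← erase_insert hxZ', h]
    · rw [disjoint_left]
      intro Z hZ hZ'
      obtain ⟨Z', -, rfl⟩ := mem_image.1 hZ'
      exact hdisj.1 ((mem_powersetCard.1 hZ).1 (mem_insert_self _ _))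

/-- A word violating the lattice condition is rewritten, by a Garnir-type relation, through
lexicographically smaller words with the same letter sum. -/
theorem eq_zero_of_isLattice {F : Word n d → N} {m : ℕ}
    (hF : ∀ a b : Fin n, (b : ℕ) = a + 1 → ∀ i k, 1 ≤ k → letterSum i + k = m →
      ∑ Z ∈ powersetCard k (univ.filter fun p => i p = a), F (setOn i Z b) = 0)
    (hL : ∀ j, IsLattice j → letterSum j = m → F j = 0) (j : Word n d) (hj : letterSum j = m) :
    F j = 0 := by
  suffices h : ∀ x : Lex (Fin d → Fin n), letterSum (ofLex x) = m → F (ofLex x) = 0 from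
    h (toLex j) hj
  intro x
  induction x using WellFoundedLT.induction with
  | _ x ih =>
  intro hx
  clear hj j
  generalize hxj : ofLex x = j at hx ⊢
  by_cases hlat : IsLattice j
  · exact hL j hlat hx
  simp only [IsLattice, not_forall, not_le] at hlat
  obtain ⟨a, b, hab, p, hlt⟩ := hlat
  have hne : a ≠ b := fun h => by simp [h] at hab
  -- The violation at `p` says `#A < #Y`, which is what the relation needs. It redistributes the
  -- letters `b` of `Y` over `X ∪ Y`; the term `Z = Y` is `j` itself.
  set Y : Finset (Fin d) := univ.filter fun q => q ≤ p ∧ j q = b with hY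
  set X : Finset (Fin d) := univ.filter fun q => p < q ∧ j q = a with hX
  set A : Finset (Fin d) := univ.filter fun q => q ≤ p ∧ j q = a with hA
  set i := setOn j Y a with hi
  have hiY : setOn i Y b = j := by
    funext q
    simp only [hi, setOn]
    split_ifs with hq
    · simp only [hY, mem_filter] at hq
      exact hq.2.2.symm
    · rfl
  have hia : ∀ q, i q = a ↔ q ∈ A ∨ q ∈ X ∪ Y := by
    intro q
    simp only [hi, setOn, mem_union, hA, hX, hY, mem_filter, mem_univ, true_and]
    rcases le_or_gt q p with hq | hq
    · simp only [hq, not_lt.2 hq, true_and, false_and, false_or]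
      split_ifs <;> simp_all
    · simp [hq, not_le.2 hq]
  have hsum : ∀ Z ⊆ X ∪ Y, letterSum (setOn i Z b) = letterSum i + #Z := fun Z hZ =>
    letterSum_setOn hab fun q hq => (hia q).2 (Or.inr (hZ hq))
  have hsumj := hsum Y subset_union_right
  rw [hiY, hx] at hsumj
  have hzero := sum_powersetCard_setOn_eq_zero hab (hF a b hab) A (X ∪ Y) i #Y hia
    (by
      rw [disjoint_left]
      simp only [hA, hX, hY, mem_filter, mem_univ, true_and, mem_union]
      rintro q ⟨h1, h2⟩ (⟨h3, -⟩ | ⟨-, h3⟩)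
      · exact absurd h3 (not_lt.2 h1)
      · exact hne (h2.symm.trans h3)) hsumj.symm hlt
  rw [sum_eq_single Y, hiY] at hzero
  · exact hzero
  · intro Z hZ hZY
    obtain ⟨hZsub, hZcard⟩ := mem_powersetCard.1 hZ
    refine ih (toLex (setOn i Z b)) ?_ ?_
    · rw [← toLex_ofLex x, hxj]
      have hdiff : (Y \ Z).Nonempty := by
        rw [sdiff_nonempty]
        exact fun h => hZY (eq_of_subset_of_card_le h hZcard.le).symm
      -- Since `X` lies after `p`, this is the first position where the new word differs from `j`,
      -- and there `b` has become `a`.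
      set q := (Y \ Z).min' hdiff
      have hq : q ∈ Y ∧ q ∉ Z := mem_sdiff.1 (min'_mem _ hdiff)
      have hqY : q ≤ p ∧ j q = b := by simpa [hY] using hq.1
      refine toLex_lt_iff.2 ⟨q, fun r hr => ?_, ?_⟩
      · have hrX : r ∉ X := by
          simp only [hX, mem_filter, mem_univ, true_and, not_and]
          exact fun h => absurd (hr.trans_le hqY.1) (not_lt.2 h.le)
        have hrYZ : r ∈ Y → r ∈ Z := fun h => by
          by_contra h'
          exact absurd (min'_le _ r (mem_sdiff.2 ⟨h, h'⟩)) (not_le.2 hr)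
        have hrZY : r ∈ Z → r ∈ Y := fun h => (mem_union.1 (hZsub h)).resolve_left hrX
        conv_rhs => rw [← hiY]
        simp only [setOn]
        rw [if_congr ⟨hrZY, hrYZ⟩ rfl rfl]
      · have : setOn i Z b q = a := by
          simp only [setOn, if_neg hq.2]
          exact (hia q).2 (Or.inr (mem_union_right _ hq.1))
        rw [this, hqY.2, Fin.lt_def, hab]
        exact Nat.lt_succ_self _
    · rw [ofLex_toLex, hsum Z hZsub, hZcard, hsumj]
  · intro h
    exact absurd (mem_powersetCard.2 ⟨subset_union_right, rfl⟩) h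

end Straightening

/-! ### The commutant of the place-invariant matrices is spanned by place permutations. -/

section Commutant

variable {R : Type*} [CommRing R] {n d : ℕ}

/-- The matrix of a place permutation. -/
def placeMatrix (R : Type*) [CommRing R] {n d : ℕ} (σ : Equiv.Perm (Fin d)) :
    Matrix (Word n d) (Word n d) R :=
  Matrix.of fun i j => if i ∘ σ = j then 1 else 0

/-- The span of the place permutations. -/
def placeSpan (R : Type*) [CommRing R] (n d : ℕ) :
    Submodule R (Matrix (Word n d) (Word n d) R) :=
  Submodule.span R (Set.range (placeMatrix R))

theorem IsPlaceInvariant.commute_of_mem_placeSpan {K : Matrix (Word n d) (Word n d) R}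
    (hK : IsPlaceInvariant K) {T : Matrix (Word n d) (Word n d) R} (hT : T ∈ placeSpan R n d) :
    Commute T K := by
  induction hT using Submodule.span_induction with
  | mem T hT =>
    obtain ⟨σ, rfl⟩ := hT
    ext i j
    have h : ∀ l : Word n d, l ∘ σ = j ↔ l = j ∘ σ.symm := fun l => by
      constructor
      · rintro rfl; funext p; simp
      · rintro rfl; funext p; simp
    simp only [Matrix.mul_apply, placeMatrix, Matrix.of_apply, h]
    simp only [ite_mul, one_mul, zero_mul, mul_ite, mul_one, mul_zero, sum_ite_eq, sum_ite_eq',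
      mem_univ, if_true]
    rw [← hK σ i]
    congr 1
    funext p
    simp
  | zero => exact Commute.zero_left K
  | add T T' _ _ h h' => exact h.add_left h'
  | smul r T _ h => exact h.smul_left r

/-- Commuting with a divided power trades `a → b` in the row index for `b → a` in the column index.
With `b = a + 1` the latter lowers the letter sum, so induction on it supplies the relations needed
for straightening. -/
theorem eq_zero_of_commute {T : Matrix (Word n d) (Word n d) R}
    (hT : ∀ K, IsPlaceInvariant K → Commute T K)
    (h0 : ∀ s t, IsLattice s → IsLattice t → T s t = 0) : T = 0 := by
  suffices h : ∀ m j, letterSum j = m → ∀ i, T i j = 0 by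
    ext i j
    exact h _ j rfl i
  intro m
  induction m using Nat.strong_induction_on with
  | _ m ih =>
  have hD : ∀ (a b : Fin n) k i j,
      ∑ Z ∈ powersetCard k (univ.filter fun p => i p = a), T (setOn i Z b) j =
        ∑ Z ∈ powersetCard k (univ.filter fun p => j p = b), T i (setOn j Z a) := by
    intro a b k i j
    rw [← dividedPower_mul_apply, ← mul_dividedPower_apply,
      (hT _ (isPlaceInvariant_dividedPower a b k)).eq]
  have hlat : ∀ j, IsLattice j → letterSum j = m → ∀ i, T i j = 0 := by
    intro j hj hjm i
    -- The row index is straightened for a lattice column index; afterwards the column index is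
    -- straightened for a fixed row index.
    refine eq_zero_of_isLattice (F := fun i => T i j) (fun a b hab i k hk _ => ?_)
      (fun i hi _ => h0 i j hi hj) i rfl
    rw [hD]
    refine sum_eq_zero fun Z hZ => ?_
    obtain ⟨hZsub, hZcard⟩ := mem_powersetCard.1 hZ
    have hne : a ≠ b := fun h => by simp [h] at hab
    have hback : setOn (setOn j Z a) Z b = j := by
      funext p
      simp only [setOn]
      split_ifs with hp
      · exact (mem_filter.1 (hZsub hp)).2.symm
      · rfl
    have := letterSum_setOn hab (i := setOn j Z a) (Z := Z) fun p hp => by simp [setOn, hp]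
    rw [hback, hZcard] at this
    exact ih _ (by omega) _ rfl i
  intro j hj i
  refine eq_zero_of_isLattice (F := fun j => T i j) (m := m) (fun a b hab j k hk hjk => ?_)
    (fun j hj hjm => hlat j hj hjm i) j hj
  rw [← hD]
  exact sum_eq_zero fun Z _ => ih (letterSum j) (by omega) j rfl _

theorem apply_eq_zero_of_commute {T : Matrix (Word n d) (Word n d) R}
    (hT : ∀ K, IsPlaceInvariant K → Commute T K) {i j : Word n d} {a : Fin n}
    (h : #{p | i p = a} ≠ #{p | j p = a}) : T i j = 0 := by
  have hinv : IsPlaceInvariant (letterProj R (d := d) a #{p | i p = a}) := by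
    intro σ l l'
    have : #{p | l (σ p) = a} = #{p | l p = a} := card_equiv σ (by simp)
    simp [letterProj, Matrix.diagonal_apply, this, σ.surjective.injective_comp_right.eq_iff]
  have := congrFun (congrFun (hT _ hinv).eq i) j
  simpa [letterProj, h.symm] using this.symm

/-- The signed column sum of the tableau of `t`, followed by the place permutation `w`. -/
def columnAntisymmetrizer (R : Type*) [CommRing R] {n d : ℕ} (t : Word n d)
    (w : Equiv.Perm (Fin d)) : Matrix (Word n d) (Word n d) R :=
  ∑ π ∈ univ.filter fun π : Equiv.Perm (Fin d) => ∀ p, column t (π p) = column t p,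
    ((Equiv.Perm.sign π : ℤ) : R) • placeMatrix R (w * π)

theorem columnAntisymmetrizer_mem (t : Word n d) (w : Equiv.Perm (Fin d)) :
    columnAntisymmetrizer R t w ∈ placeSpan R n d :=
  Submodule.sum_mem _ fun _ _ => Submodule.smul_mem _ _ (Submodule.subset_span ⟨_, rfl⟩)

theorem columnAntisymmetrizer_apply (t : Word n d) (w : Equiv.Perm (Fin d)) (i j : Word n d) :
    columnAntisymmetrizer R t w i j =
      ∑ π ∈ univ.filter fun π : Equiv.Perm (Fin d) => ∀ p, column t (π p) = column t p,
        if ∀ p, i (w (π p)) = j p then ((Equiv.Perm.sign π : ℤ) : R) else 0 := by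
  simp [columnAntisymmetrizer, Matrix.sum_apply, placeMatrix, funext_iff]

theorem columnAntisymmetrizer_apply_self {s t : Word n d} {w : Equiv.Perm (Fin d)}
    (hw : ∀ p, s (w p) = t p) : columnAntisymmetrizer R t w s t = 1 := by
  rw [columnAntisymmetrizer_apply, sum_eq_single 1]
  · simp [hw]
  · intro π hπ hne
    rw [if_neg]
    intro h
    refine hne (Equiv.ext fun p => ?_)
    exact eq_of_column_eq ((hw _).symm.trans (h p)) ((mem_filter.1 hπ).2 p)
  · simp

/-- If `j` repeats a letter in a column, multiplication by the transposition of the two positions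
cancels the terms in pairs of opposite sign. -/
theorem injOnColumns_of_columnAntisymmetrizer_apply_ne_zero {t i j : Word n d}
    {w : Equiv.Perm (Fin d)} (h : columnAntisymmetrizer R t w i j ≠ 0) : InjOnColumns j t := by
  intro p q hc hj
  by_contra hpq
  refine h ?_
  rw [columnAntisymmetrizer_apply]
  have hcs : ∀ r, column t (Equiv.swap p q r) = column t r := fun r => by
    rw [Equiv.swap_apply_def]; split_ifs <;> simp_all
  have hjs : ∀ r, j (Equiv.swap p q r) = j r := fun r => by
    rw [Equiv.swap_apply_def]; split_ifs <;> simp_all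
  have hiff : ∀ π : Equiv.Perm (Fin d),
      (∀ r, i (w ((π * Equiv.swap p q) r)) = j r) ↔ ∀ r, i (w (π r)) = j r := fun π => by
    rw [← (Equiv.swap p q).forall_congr_right (q := fun r => i (w (π r)) = j r)]
    simp [hjs]
  refine sum_involution (fun π _ => π * Equiv.swap p q) (fun π _ => ?_) (fun π _ _ h => ?_)
    (fun π hπ => ?_) (fun π _ => ?_)
  · simp only [hiff]
    split_ifs
    · simp [Equiv.Perm.sign_swap hpq]
    · simp
  · exact hpq (Equiv.swap_eq_one_iff.1 (mul_eq_left.1 h))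
  · simp only [mem_filter, mem_univ, true_and, Equiv.Perm.mul_apply] at hπ ⊢
    exact fun r => (hπ _).trans (hcs r)
  · simp [mul_assoc]

theorem injOnColumns_of_columnAntisymmetrizer_apply_self_ne_zero {s t i : Word n d}
    {w : Equiv.Perm (Fin d)} (hw : ∀ p, column s (w p) = column t p)
    (h : columnAntisymmetrizer R t w i t ≠ 0) : InjOnColumns i s := by
  rw [columnAntisymmetrizer_apply] at h
  obtain ⟨π, hπ, hne⟩ := exists_ne_zero_of_sum_ne_zero h
  have hi : ∀ p, i (w (π p)) = t p := by
    by_contra h'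
    exact hne (if_neg h')
  intro p q hc hpq
  obtain ⟨p, rfl⟩ := (w * π).surjective p
  obtain ⟨q, rfl⟩ := (w * π).surjective q
  simp only [Equiv.Perm.mul_apply, hw, hi, (mem_filter.1 hπ).2 _] at hc hpq
  rw [eq_of_column_eq hpq hc]

/-- Unitriangular elimination: the coordinates are cleared in increasing order, each correction
leaving the smaller ones untouched. -/
theorem exists_mem_forall_sub_eq_zero {I V : Type*} [LinearOrder I] [AddCommGroup V] [Module R V]
    (Q : Submodule R V) (φ : I → V →ₗ[R] R) (S : Finset I)
    (hS : ∀ x ∈ S, ∃ h ∈ Q, φ x h = 1 ∧ ∀ y ∈ S, y < x → φ y h = 0) (v : V) :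
    ∃ h ∈ Q, ∀ x ∈ S, φ x (v - h) = 0 := by
  induction S using Finset.induction_on_max with
  | empty => exact ⟨0, Q.zero_mem, by simp⟩
  | insert a S ha ih =>
    obtain ⟨h, hQ, h0⟩ := ih fun x hx => by
      obtain ⟨h, hQ, h1, h0⟩ := hS x (mem_insert_of_mem hx)
      exact ⟨h, hQ, h1, fun y hy => h0 y (mem_insert_of_mem hy)⟩
    obtain ⟨g, gQ, g1, g0⟩ := hS a (mem_insert_self _ _)
    refine ⟨h + φ a (v - h) • g, Q.add_mem hQ (Q.smul_mem _ gQ), fun x hx => ?_⟩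
    rw [← sub_sub, map_sub, map_smul]
    rcases mem_insert.1 hx with rfl | hx
    · simp [g1]
    · simp [h0 x hx, g0 x (mem_insert_of_mem hx) (ha x hx)]

theorem mem_placeSpan_of_commute {T : Matrix (Word n d) (Word n d) R}
    (hT : ∀ K, IsPlaceInvariant K → Commute T K) : T ∈ placeSpan R n d := by
  classical
  let φ : ℕ ×ₗ (Lex (Word n d) ×ₗ Lex (Word n d)) → Matrix (Word n d) (Word n d) R →ₗ[R] R :=
    fun x => Matrix.entryLinearMap R R (ofLex (ofLex (ofLex x).2).2) (ofLex (ofLex (ofLex x).2).1)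
  -- Entries are ordered by the column index `t` first and the row index `s` last: a nonzero entry
  -- forces `t ≤ t'`, and the bound `s ≤ s'` is available only when `t' = t`.
  let key : Word n d × Word n d → ℕ ×ₗ (Lex (Word n d) ×ₗ Lex (Word n d)) :=
    fun x => toLex (letterSum x.2, toLex (toLex x.2, toLex x.1))
  let S : Finset (Word n d × Word n d) := univ.filter fun x =>
    IsLattice x.1 ∧ IsLattice x.2 ∧ ∀ a, #{p | x.1 p = a} = #{p | x.2 p = a}
  obtain ⟨h, hQ, h0⟩ := exists_mem_forall_sub_eq_zero (placeSpan R n d) φ (S.image key)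
    (by
      intro x hx
      obtain ⟨⟨s, t⟩, hst, rfl⟩ := mem_image.1 hx
      obtain ⟨hs, ht, hwt⟩ : IsLattice s ∧ IsLattice t ∧ ∀ a, #{p | s p = a} = #{p | t p = a} :=
        (mem_filter.1 hst).2
      obtain ⟨w, hw, hwc⟩ := exists_perm_column hwt
      refine ⟨columnAntisymmetrizer R t w, columnAntisymmetrizer_mem t w,
        columnAntisymmetrizer_apply_self hw, fun y hy hlt => ?_⟩
      obtain ⟨⟨s', t'⟩, -, rfl⟩ := mem_image.1 hy
      by_contra hne
      change columnAntisymmetrizer R t w s' t' ≠ 0 at hne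
      have hinj := injOnColumns_of_columnAntisymmetrizer_apply_ne_zero hne
      refine absurd hlt (not_lt.2 ?_)
      simp only [key, Prod.Lex.toLex_le_toLex]
      rcases (hinj.letterSum_le ht).lt_or_eq with hl | hl
      · exact Or.inl hl
      refine Or.inr ⟨hl, ?_⟩
      rcases (hinj.toLex_le ht).lt_or_eq with hl | hl
      · exact Or.inl hl
      refine Or.inr ⟨hl, ?_⟩
      obtain rfl : t = t' := toLex.injective hl
      exact (injOnColumns_of_columnAntisymmetrizer_apply_self_ne_zero hwc hne).toLex_le hs) T
  have hcomm : ∀ K, IsPlaceInvariant K → Commute (T - h) K := fun K hK =>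
    (hT K hK).sub_left (hK.commute_of_mem_placeSpan hQ)
  have hzero : T - h = 0 := by
    refine eq_zero_of_commute hcomm fun s t hs ht => ?_
    by_cases hwt : ∀ a, #{p | s p = a} = #{p | t p = a}
    · exact h0 (key (s, t)) (mem_image_of_mem key (mem_filter.2 ⟨mem_univ _, hs, ht, hwt⟩))
    · push Not at hwt
      obtain ⟨a, ha⟩ := hwt
      exact apply_eq_zero_of_commute hcomm ha
  rw [sub_eq_zero.1 hzero]
  exact hQ

end Commutant

/-! ### Transfer from matrices to endomorphisms of the tensor power. -/

section Transfer

variable {R : Type*} [CommRing R] {n d : ℕ}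

/-- The identification of the endomorphisms of the tensor power with matrices indexed by words. -/
def endEquivMatrix (R : Type*) [CommRing R] (n d : ℕ) :
    Module.End R (TensorPower R n d) ≃ₐ[R] Matrix (Word n d) (Word n d) R :=
  LinearMap.toMatrixAlgEquiv (Basis.piTensorProduct fun _ : Fin d => Pi.basisFun R (Fin n))

theorem endEquivMatrix_glRep (g : Matrix.GeneralLinearGroup (Fin n) R) :
    endEquivMatrix R n d (glRep R n d g) =
      kroneckerPower d (g : Matrix (Fin n) (Fin n) R) := by
  ext i j
  rw [endEquivMatrix, LinearMap.toMatrixAlgEquiv_apply, Basis.piTensorProduct_apply, glRep_tprod,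
    Basis.piTensorProduct_repr_tprod_apply]
  simp [kroneckerPower]

theorem endEquivMatrix_permRep (σ : Equiv.Perm (Fin d)) :
    endEquivMatrix R n d (permRep R n d σ) = placeMatrix R σ := by
  ext i j
  rw [endEquivMatrix, LinearMap.toMatrixAlgEquiv_apply, Basis.piTensorProduct_apply, permRep_tprod,
    Basis.piTensorProduct_repr_tprod_apply]
  have h : i ∘ σ = j ↔ ∀ p, i p = j (σ⁻¹ p) := by
    rw [funext_iff, ← σ.forall_congr_right (q := fun p => i p = j (σ⁻¹ p))]
    simp
  simp only [placeMatrix, Matrix.of_apply, h, Pi.basisFun_apply, Pi.basisFun_repr, Pi.single_apply]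
  rw [prod_ite_zero]
  simp

theorem isPlaceInvariant_endEquivMatrix {f : Module.End R (TensorPower R n d)}
    (hf : f ∈ schurAlgebra R n d) : IsPlaceInvariant (endEquivMatrix R n d f) := by
  intro σ i j
  have hcomm : permRep R n d σ * f = f * permRep R n d σ :=
    (Subalgebra.mem_centralizer_iff R).1 hf _
      ⟨MonoidAlgebra.single σ 1, by simp [Representation.asAlgebraHom_single]⟩
  have := congrArg (endEquivMatrix R n d) hcomm
  rw [map_mul, map_mul, endEquivMatrix_permRep] at this
  have hij := congrFun (congrFun this i) (j ∘ σ)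
  simpa [Matrix.mul_apply, placeMatrix, σ.surjective.injective_comp_right.eq_iff] using hij

variable {s : Fin (d + 1) → R}

theorem IsPlaceInvariant.mem_range {K : Matrix (Word n d) (Word n d) R} (hK : IsPlaceInvariant K)
    (hs : ∀ i j, i ≠ j → IsUnit (s i - s j)) :
    ∃ a, endEquivMatrix R n d ((glRep R n d).asAlgebraHom a) = K := by
  refine (AlgHom.mem_range
    ((endEquivMatrix R n d).toAlgHom.comp (glRep R n d).asAlgebraHom)).1
    (hK.mem_of_kroneckerPower_mem (fun g hg => ?_) hs)
  refine ⟨MonoidAlgebra.single (Matrix.GeneralLinearGroup.mk'' g hg) 1, ?_⟩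
  change endEquivMatrix R n d ((glRep R n d).asAlgebraHom _) = _
  rw [Representation.asAlgebraHom_single, one_smul, endEquivMatrix_glRep]
  rfl

theorem rho_surjective (hs : ∀ i j, i ≠ j → IsUnit (s i - s j)) :
    Function.Surjective (rho R n d) := by
  rintro ⟨f, hf⟩
  obtain ⟨a, ha⟩ := (isPlaceInvariant_endEquivMatrix hf).mem_range hs
  exact ⟨a, Subtype.ext ((endEquivMatrix R n d).injective ha)⟩

theorem psi_surjective (hs : ∀ i j, i ≠ j → IsUnit (s i - s j)) :
    Function.Surjective (psi R n d) := by
  rintro ⟨f, hf⟩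
  -- Every place-invariant matrix comes from the group algebra of `GL_n(R)`, so commuting with that
  -- action means commuting with all of them.
  have hcomm : ∀ K, IsPlaceInvariant K → Commute (endEquivMatrix R n d f) K := by
    intro K hK
    obtain ⟨a, rfl⟩ := hK.mem_range hs
    have := (Subalgebra.mem_centralizer_iff R).1 hf _ ⟨a, rfl⟩
    exact (show Commute f _ from this.symm).map (endEquivMatrix R n d)
  have hle : placeSpan R n d ≤ Subalgebra.toSubmodule
      ((endEquivMatrix R n d).toAlgHom.comp (permRep R n d).asAlgebraHom).range := by
    refine Submodule.span_le.2 ?_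
    rintro _ ⟨σ, rfl⟩
    refine ⟨MonoidAlgebra.single σ 1, ?_⟩
    change endEquivMatrix R n d ((permRep R n d).asAlgebraHom _) = _
    rw [Representation.asAlgebraHom_single, one_smul, endEquivMatrix_permRep]
  obtain ⟨a, ha⟩ := hle (mem_placeSpan_of_commute hcomm)
  exact ⟨a, Subtype.ext ((endEquivMatrix R n d).injective ha)⟩

end Transfer

end SchurWeyl

end

theorem mainTheorem1 (n d : ℕ) {R : Type*} [CommRing R] (S : Set R)
    (hS : ∀ x ∈ S, ∀ y ∈ S, x ≠ y → IsUnit (x - y))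
    (hcard : (d : ℕ∞) < S.encard) :
    Function.Surjective (SchurWeyl.rho R n d) ∧ SchurWeyl.SchurWeylDuality R n d := by
  obtain ⟨t, htS, ht⟩ := Set.exists_subset_encard_eq (Order.add_one_le_of_lt hcard)
  have hfin : t.Finite := Set.finite_of_encard_eq_coe (k := d + 1) (by simpa using ht)
  have hcard' : hfin.toFinset.card = d + 1 := by
    rw [hfin.encard_eq_coe_toFinset_card] at ht
    exact_mod_cast ht
  let e := hfin.toFinset.equivFinOfCardEq hcard'
  have hmem : ∀ i, (e.symm i : R) ∈ S := fun i => htS (hfin.mem_toFinset.1 (e.symm i).2)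
  have hs : ∀ i j, i ≠ j → IsUnit ((e.symm i : R) - e.symm j) := fun i j hij =>
    hS _ (hmem i) _ (hmem j) fun h => hij (e.symm.injective (Subtype.ext h))
  have hrho := SchurWeyl.rho_surjective (n := n) (s := fun i => (e.symm i : R)) hs
  exact ⟨hrho, hrho, SchurWeyl.psi_surjective (s := fun i => (e.symm i : R)) hs⟩
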